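/- Let $M$ be a connected, complete, noncompact smooth Riemannian manifold (without boundary). A ray in $M$ is a minimal geodesic $\gamma:[0,\infty)\to M$ parametrized by arclength, i.e. $d(\gamma(s),\gamma(t))=|s-t|$ for all $s,t\ge 0$. A loop $\bar C$ is homotopic along $\gamma$ to a loop $C$ based at $\gamma(0)$ if there is $r>0$ such that $\bar C$ is based at $\gamma(r)$ and the loop obtained by running along $\gamma$ from $\gamma(0)$ to $\gamma(r)$, then along $\bar C$, then back along $\gamma$ from $\gamma(r)$ to $\gamma(0)$ is homotopic (with fixed base point) to $C$. Suppose that $M$ has the loops to infinity property: for every ray $\gamma$, every $g\in\pi_1(M,\gamma(0))$ and every compact set $K\subset M$ there are a loop $C$ with $[C]=g$ and a loop $\bar C$ contained in $M\setminus K$ that is homotopic to $C$ along $\gamma$. Let $D\subset M$ be a precompact region with smooth boundary, i.e. a nonempty connected open set with compact closure such that near every point of $\partial D$ there is a smooth chart of $M$ in which $D$ is the set where one coordinate is negative. If $\partial D$ is simply connected (in particular path connected), then $\pi_1(D,x)$ is trivial for every $x\in D$. -/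

import Mathlib

open Set Manifold Bundle
open scoped NNReal ContDiff

/-- A ray in a metric space: a curve `[0, ∞) → M` with `dist (γ s) (γ t) = |s - t|`.  In a complete
Riemannian manifold these are exactly the minimal geodesics `[0, ∞) → M` parametrized
by arclength. -/
structure Ray (M : Type*) [MetricSpace M] where
  toFun : ℝ≥0 → M
  isometry_toFun : Isometry toFun

namespace Ray

variable {M : Type*} [MetricSpace M]

instance : CoeFun (Ray M) (fun _ => ℝ≥0 → M) := ⟨Ray.toFun⟩

/-- The initial segment of a ray from `γ 0` to `γ r`, as a path on `[0, 1]`. -/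
def segment (γ : Ray M) (r : ℝ≥0) : Path (γ 0) (γ r) where
  toFun s := γ (r * Real.toNNReal s)
  continuous_toFun := by
    have := γ.isometry_toFun.continuous
    fun_prop
  source' := by simp
  target' := by simp

/-- The loop `C'` (based at `y`) is homotopic to the loop `C` (based at `γ 0`) along the ray `γ`:
`y = γ r` for some `r > 0`, and running along `γ` from `γ 0` to `γ r`, then along `C'`, then back
along `γ` is a loop homotopic to `C`, with fixed base point. -/
def HomotopicAlong (γ : Ray M) {y : M} (C' : Path y y) (C : Path (γ 0) (γ 0)) : Prop :=
  ∃ r : ℝ≥0, 0 < r ∧ ∃ h : γ r = y,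
    Path.Homotopic (((γ.segment r).trans (C'.cast h h)).trans (γ.segment r).symm) C

/-- The element `g` of the fundamental group at `γ 0` has the loops to infinity property along the
ray `γ`. -/
def HasLoopsToInfinity (γ : Ray M) (g : FundamentalGroup M (γ 0)) : Prop :=
  ∀ K : Set M, IsCompact K →
    ∃ C : Path (γ 0) (γ 0), FundamentalGroup.fromPath (Path.Homotopic.Quotient.mk C) = g ∧
      ∃ (y : M) (C' : Path y y), range C' ⊆ Kᶜ ∧ γ.HomotopicAlong C' C

end Ray

/-- `M` has the loops to infinity property. -/
def LoopsToInfinity (M : Type*) [MetricSpace M] : Prop :=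
  ∀ (γ : Ray M) (g : FundamentalGroup M (γ 0)), γ.HasLoopsToInfinity g

/-- `D` has smooth boundary: around each boundary point there is a smooth chart of the manifold in
which `D` is the part of the chart domain where one of the coordinates is negative. -/
def HasSmoothBoundary (n : ℕ) {M : Type*} [TopologicalSpace M]
    [ChartedSpace (EuclideanSpace ℝ (Fin n)) M] (D : Set M) : Prop :=
  ∀ p ∈ frontier D, ∃ φ ∈ IsManifold.maximalAtlas (𝓡 n) ∞ M,
    p ∈ φ.source ∧ ∃ i : Fin n, ∀ x ∈ φ.source, x ∈ D ↔ φ x i < 0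

/-- `D` is a precompact region with smooth boundary: open, connected (and non-empty), with compact
closure and smooth boundary. -/
structure IsPrecompactSmoothRegion (n : ℕ) {M : Type*} [TopologicalSpace M]
    [ChartedSpace (EuclideanSpace ℝ (Fin n)) M] (D : Set M) : Prop where
  isOpen : IsOpen D
  isConnected : IsConnected D
  isCompact_closure : IsCompact (closure D)
  hasSmoothBoundary : HasSmoothBoundary n D

/-! By Hopf–Rinow every `x` in `D` is the origin of a ray, so a loop `C` in `D` at `x` is homotopic
in `M` to `γ C' γ⁻¹` with `C'` outside `closure D`. It remains to see that such a `C` is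
nullhomotopic already in `D` (`HasSimplyConnectedTraces.homotopic_refl`).

Instead of van Kampen, the proof uses coverings. The universal local system on `D` has fiber `G`,
the opposite group of `π₁(D, x)`. It is trivial near the frontier, because the frontier is simply
connected (`exists_isFlat_frontier`), so it extends over `M` by the trivial system outside `D`. The
monodromy of the resulting covering is trivial along `C'`, hence along its conjugate `C`. Along `C`
it is also the class of `C` in `D`, up to conjugation (`eq_of_homotopic_conj`,
`PathRep.exists_faithful`). -/

open Filter Topology

/-! ### Čech cocycles and their coverings -/

/-- A Čech cocycle on `X` with locally constant values in the group `G`. -/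
structure CechCocycle (ι X G : Type*) [TopologicalSpace X] [Group G] where
  baseSet : ι → Set X
  isOpen_baseSet : ∀ i, IsOpen (baseSet i)
  indexAt : X → ι
  mem_baseSet_at : ∀ x, x ∈ baseSet (indexAt x)
  change : ι → ι → X → G
  change_mul : ∀ i j k, ∀ x ∈ baseSet i ∩ baseSet j ∩ baseSet k,
    change i j x * change j k x = change i k x
  eventually_change_eq : ∀ i j, ∀ x ∈ baseSet i ∩ baseSet j,
    ∀ᶠ y in 𝓝 x, change i j y = change i j x

namespace CechCocycle

variable {ι X G : Type*} [TopologicalSpace X] [Group G] (Z : CechCocycle ι X G)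

lemma change_self {i : ι} {x : X} (hx : x ∈ Z.baseSet i) : Z.change i i x = 1 := by
  simpa using Z.change_mul i i i x ⟨⟨hx, hx⟩, hx⟩

variable [TopologicalSpace G] [DiscreteTopology G]

/-- The bundle of discrete fibers `G` glued from a cocycle by right multiplication. -/
def core : FiberBundleCore ι X G where
  baseSet := Z.baseSet
  isOpen_baseSet := Z.isOpen_baseSet
  indexAt := Z.indexAt
  mem_baseSet_at := Z.mem_baseSet_at
  coordChange i j x g := g * Z.change i j x
  coordChange_self i x hx v := by rw [Z.change_self hx, mul_one]
  continuousOn_coordChange i j := by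
    rintro ⟨x, g⟩ ⟨hx, -⟩
    refine ContinuousAt.continuousWithinAt ?_
    have h1 : ∀ᶠ p : X × G in 𝓝 (x, g), Z.change i j p.1 = Z.change i j x :=
      (continuous_fst.tendsto (x, g)).eventually (Z.eventually_change_eq i j x hx)
    have h2 : ContinuousAt (fun p : X × G => p.2 * Z.change i j x) (x, g) :=
      (continuous_of_discreteTopology (f := fun v : G => v * Z.change i j x)).continuousAt.comp
        continuousAt_snd
    exact h2.congr (h1.mono fun p hp => by simp only [hp])
  coordChange_comp i j k x hx v := by rw [mul_assoc, Z.change_mul i j k x hx]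

lemma isCoveringMap : IsCoveringMap Z.core.proj :=
  FiberBundle.isCoveringMap (F := G) (E := Z.core.Fiber)

/-- A family of values in the trivializations, locally constant and compatible with the changes
of trivialization along a continuous map, defines a continuous lift of that map. -/
lemma continuous_mk {A : Type*} [TopologicalSpace A] {f : A → X} (hf : Continuous f)
    (v : A → G)
    (hv : ∀ a, ∃ i, f a ∈ Z.baseSet i ∧ ∀ᶠ b in 𝓝 a,
      v b * Z.change (Z.indexAt (f b)) i (f b) = v a * Z.change (Z.indexAt (f a)) i (f a)) :
    Continuous (fun a => (⟨f a, v a⟩ : Z.core.TotalSpace)) := by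
  refine continuous_iff_continuousAt.2 fun a => ?_
  obtain ⟨i, hi, hev⟩ := hv a
  refine ((Z.core.localTriv i).toOpenPartialHomeomorph.continuousAt_iff_continuousAt_comp_left
    ?_).2 ?_
  · exact hf.continuousAt ((Z.isOpen_baseSet i).mem_nhds hi)
  · have h2 : ContinuousAt (fun b => (f b, v a * Z.change (Z.indexAt (f a)) i (f a))) a :=
      hf.continuousAt.prodMk continuousAt_const
    refine h2.congr (hev.mono fun b hb => ?_)
    simp only [← hb]
    rfl

/-- The identity of a simply connected, locally path connected base lifts to the covering. The
coordinates of this global section are locally constant because the fiber is discrete, and they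
write the cocycle as a coboundary. -/
lemma exists_section [SimplyConnectedSpace X] [LocallyPathConnectedSpace X] :
    ∃ s : ι → X → G, (∀ i, ∀ x ∈ Z.baseSet i, ∀ᶠ y in 𝓝 x, s i y = s i x) ∧
      ∀ i j, ∀ x ∈ Z.baseSet i ∩ Z.baseSet j, s j x = s i x * Z.change i j x := by
  obtain ⟨x₀⟩ : Nonempty X := inferInstance
  obtain ⟨F, ⟨-, hF⟩, -⟩ := Z.isCoveringMap.existsUnique_continuousMap_lifts
    (ContinuousMap.id X) x₀ ⟨x₀, (1 : G)⟩ rfl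
  have hF' : ∀ x, (F x).1 = x := fun x => congrFun hF x
  refine ⟨fun i x => (Z.core.localTriv i (F x)).2, fun i x hx => ?_, fun i j x hx => ?_⟩
  · have h1 : ContinuousAt (fun y => (Z.core.localTriv i (F y)).2) x := by
      have : ContinuousAt (Z.core.localTriv i) (F x) := by
        refine (Z.core.localTriv i).toOpenPartialHomeomorph.continuousAt ?_
        change (F x).1 ∈ Z.baseSet i
        rwa [hF']
      exact continuousAt_snd.comp (this.comp F.continuous.continuousAt)
    exact h1.eventually (isOpen_discrete {(Z.core.localTriv i (F x)).2} |>.mem_nhds rfl)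
  · change (show G from (F x).2) * Z.change (Z.indexAt (F x).1) j (F x).1
      = (show G from (F x).2) * Z.change (Z.indexAt (F x).1) i (F x).1 * Z.change i j x
    rw [hF', mul_assoc, Z.change_mul _ _ _ _ ⟨⟨Z.mem_baseSet_at x, hx.1⟩, hx.2⟩]

end CechCocycle

/-! ### Monodromy, and coverings defined by functions with locally constant quotients -/

namespace IsCoveringMap

variable {E X : Type*} [TopologicalSpace E] [TopologicalSpace X] {p : E → X}

lemma monodromy_mk_eq (cov : IsCoveringMap p) {x y : X} (γ : Path x y) (e : p ⁻¹' {x})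
    (e' : p ⁻¹' {y}) (Γ : C(unitInterval, E)) (hΓ : p ∘ Γ = γ) (h0 : Γ 0 = e) (h1 : Γ 1 = e') :
    cov.monodromy (.mk γ) e = e' := by
  refine Subtype.ext ?_
  rw [← h1, (cov.eq_liftPath_iff' (γ_0 := γ.source.trans e.2.symm)).2 ⟨hΓ, h0⟩]
  rfl

/-- A loop conjugate to a loop with trivial monodromy has trivial monodromy. -/
lemma monodromy_conj_eq (cov : IsCoveringMap p) {x y : X} (γ : Path x y) (C' : Path y y)
    (h : ∀ e, cov.monodromy (.mk C') e = e) (e : p ⁻¹' {x}) :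
    cov.monodromy (.mk ((γ.trans C').trans γ.symm)) e = e := by
  rw [Path.Homotopic.Quotient.mk_trans, Path.Homotopic.Quotient.mk_trans,
    cov.monodromy_trans_apply, cov.monodromy_trans_apply, h, ← cov.monodromy_trans_apply,
    ← Path.Homotopic.Quotient.mk_trans,
    Path.Homotopic.Quotient.eq.2 ⟨(Path.Homotopy.reflTransSymm γ).symm⟩,
    Path.Homotopic.Quotient.mk_refl, cov.monodromy_refl, id]

end IsCoveringMap

section Coboundary

variable {ι X G : Type*} [TopologicalSpace X] [Group G]

/-- Functions `h i` on open sets covering `X` whose quotients are locally constant give rise to a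
cocycle. -/
@[simps]
def CechCocycle.ofCoboundary (U : ι → Set X) (hU : ∀ i, IsOpen (U i)) (idx : X → ι)
    (hidx : ∀ x, x ∈ U (idx x)) (h : ι → X → G)
    (hh : ∀ i j, ∀ x ∈ U i ∩ U j, ∀ᶠ y in 𝓝 x, (h i y)⁻¹ * h j y = (h i x)⁻¹ * h j x) :
    CechCocycle ι X G where
  baseSet := U
  isOpen_baseSet := hU
  indexAt := idx
  mem_baseSet_at := hidx
  change i j x := (h i x)⁻¹ * h j x
  change_mul i j k x _ := by group
  eventually_change_eq := hh

/-- Let `h i` be functions on open sets covering `X` with locally constant quotients. If a loop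
`C` is conjugate to a loop `C'` along which all the `h i` are locally constant, and `g * h i ∘ C`
is locally constant for a function `g` on the unit interval, then `g 0 = g 1`. -/
theorem eq_of_homotopic_conj (U : ι → Set X) (hU : ∀ i, IsOpen (U i)) (idx : X → ι)
    (hidx : ∀ x, x ∈ U (idx x)) (h : ι → X → G)
    (hh : ∀ i j, ∀ x ∈ U i ∩ U j, ∀ᶠ y in 𝓝 x, (h i y)⁻¹ * h j y = (h i x)⁻¹ * h j x)
    {x y : X} (C : Path x x) (γ : Path x y) (C' : Path y y)
    (hC : C.Homotopic ((γ.trans C').trans γ.symm))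
    (hC' : ∀ t, ∃ i, C' t ∈ U i ∧ ∀ᶠ t' in 𝓝 t, h i (C' t') = h i (C' t))
    (g : unitInterval → G)
    (hg : ∀ t, ∃ i, C t ∈ U i ∧ ∀ᶠ t' in 𝓝 t, g t' * h i (C t') = g t * h i (C t)) :
    g 0 = g 1 := by
  let _ : TopologicalSpace G := ⊥
  have : DiscreteTopology G := ⟨rfl⟩
  -- The `h i` themselves need not be locally constant, so this covering can be nontrivial.
  let Z := CechCocycle.ofCoboundary U hU idx hidx h hh
  -- In the trivialization over `U i` the point with coordinate `g t * h (idx (β t)) (β t)` has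
  -- coordinate `g t * h i (β t)`, which is locally constant; so these points form a continuous lift
  -- of `β`.
  have lift : ∀ {a b : X} (β : Path a b) (g : unitInterval → G)
      (_ : ∀ t, ∃ i, β t ∈ U i ∧ ∀ᶠ t' in 𝓝 t, g t' * h i (β t') = g t * h i (β t))
      (v₀ v₁ : G), v₀ = g 0 * h (idx a) a → v₁ = g 1 * h (idx b) b →
      Z.isCoveringMap.monodromy (.mk β) ⟨(⟨a, v₀⟩ : Z.core.TotalSpace), rfl⟩
        = ⟨(⟨b, v₁⟩ : Z.core.TotalSpace), rfl⟩ := by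
    rintro a b β g hβ v₀ v₁ rfl rfl
    have hcont := Z.continuous_mk β.continuous (fun t => g t * h (idx (β t)) (β t)) (by
      intro t
      obtain ⟨i, hi, hev⟩ := hβ t
      refine ⟨i, hi, hev.mono fun t' ht' => ?_⟩
      simp only [Z, CechCocycle.ofCoboundary_change, CechCocycle.ofCoboundary_indexAt]
      simpa [mul_assoc] using ht')
    have key : ∀ (c : G) (z z' : X), z = z' →
        (⟨z, c * h (idx z) z⟩ : Z.core.TotalSpace) = ⟨z', c * h (idx z') z'⟩ := by
      rintro c z _ rfl
      rfl
    exact Z.isCoveringMap.monodromy_mk_eq β _ _ ⟨_, hcont⟩ rfl (key _ _ _ β.source)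
      (key _ _ _ β.target)
  have h1 := lift C g hg _ _ rfl rfl
  rw [Path.Homotopic.Quotient.eq.2 hC, Z.isCoveringMap.monodromy_conj_eq] at h1
  · have h2 := congrArg (fun e => (show G from e.1.2)) h1
    simpa using h2
  · rintro ⟨⟨y', v⟩, rfl⟩
    change G at v
    -- Along `C'` a constant `g` is allowed, and this constant makes the lift start and end at `v`.
    refine lift C' (fun _ => v * (h (idx y') y')⁻¹) (fun t => ?_) v v (by simp) (by simp)
    obtain ⟨i, hi, hev⟩ := hC' t
    exact ⟨i, hi, hev.mono fun t' ht' => by rw [ht']⟩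

end Coboundary

/-! ### Local systems on `D` and their flat sections -/

/-- A representation of the fundamental groupoid of `Y` in the group `G`, as a function
on paths. -/
structure PathRep (Y G : Type*) [TopologicalSpace Y] [Group G] where
  toFun : ∀ {a b : Y}, Path a b → G
  map_homotopic : ∀ {a b : Y} {p q : Path a b}, p.Homotopic q → toFun p = toFun q
  map_trans : ∀ {a b c : Y} (p : Path a b) (q : Path b c), toFun (p.trans q) = toFun p * toFun q

namespace PathRep

/-- Chosen paths from `x` to all points turn every path into a loop at `x`. The opposite group makes
concatenation match multiplication. The chosen path from `x` to itself need not be constant, so on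
loops at `x` this is the class up to conjugation. -/
lemma exists_faithful {Y : Type*} [TopologicalSpace Y] [PathConnectedSpace Y] (x : Y) :
    ∃ T : PathRep Y (FundamentalGroup Y x)ᵐᵒᵖ,
      ∀ C : Path x x, T.toFun C = 1 → C.Homotopic (Path.refl x) := by
  let t : ∀ a : Y, FundamentalGroupoid.mk x ⟶ FundamentalGroupoid.mk a := fun a =>
    Path.Homotopic.Quotient.mk (PathConnectedSpace.somePath x a)
  let m : ∀ {a b : Y}, Path a b → (FundamentalGroupoid.mk a ⟶ FundamentalGroupoid.mk b) :=
    fun p => Path.Homotopic.Quotient.mk p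
  refine ⟨⟨fun {a b} p => .op (CategoryTheory.CategoryStruct.comp (t a)
    (CategoryTheory.CategoryStruct.comp (m p) (CategoryTheory.Groupoid.inv (t b)))), ?_, ?_⟩, ?_⟩
  · intro a b p q h
    have : m p = m q := Path.Homotopic.Quotient.eq.2 h
    simp only [this]
  · intro a b c p q
    have : m (p.trans q) = CategoryTheory.CategoryStruct.comp (m p) (m q) := rfl
    rw [← MulOpposite.op_mul, this, CategoryTheory.End.mul_def]
    simp
  · intro C hC
    have h1 : CategoryTheory.CategoryStruct.comp (t x)
        (CategoryTheory.CategoryStruct.comp (m C) (CategoryTheory.Groupoid.inv (t x))) =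
        CategoryTheory.CategoryStruct.id _ :=
      MulOpposite.op_injective hC
    have h2 : m C = CategoryTheory.CategoryStruct.id _ := by
      have h3 := congrArg (fun f => CategoryTheory.CategoryStruct.comp
        (CategoryTheory.Groupoid.inv (t x)) (CategoryTheory.CategoryStruct.comp f (t x))) h1
      simpa using h3
    exact Path.Homotopic.Quotient.eq.1 h2

variable {X G : Type*} [TopologicalSpace X] [Group G] {D : Set X}

/-- `u` is a flat section over `U ∩ D` of the local system on `D` given by `T`. -/
def IsFlat (T : PathRep D G) (U : Set X) (u : X → G) : Prop :=
  ∀ ⦃a b : D⦄ (β : Path a b), (∀ t, (β t : X) ∈ U) → u a = T.toFun β * u b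

variable {T : PathRep D G} {U V W : Set X} {u v : X → G}

lemma IsFlat.mono (h : T.IsFlat U u) (hVU : V ⊆ U) : T.IsFlat V u :=
  fun _ _ β hβ => h β fun t => hVU (hβ t)

lemma IsFlat.mul_const (h : T.IsFlat U u) (g : G) : T.IsFlat U (fun y => u y * g) :=
  fun _ _ β hβ => by simp only [h β hβ, mul_assoc]

/-- The section at `y` is `T` of any path in `U ∩ D` from `y` to a base point. The value 1 elsewhere
is never tested. -/
lemma exists_isFlat (T : PathRep D G) (hU : IsSimplyConnected (U ∩ D)) :
    ∃ u, T.IsFlat U u := by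
  classical
  have := hU.simplyConnectedSpace
  obtain ⟨b₀⟩ : Nonempty ↥(U ∩ D) := inferInstance
  let incl : C(↥(U ∩ D), D) := ⟨fun y => ⟨y.1, y.2.2⟩, by fun_prop⟩
  let w : ↥(U ∩ D) → G := fun y =>
    T.toFun ((PathConnectedSpace.somePath y b₀).map incl.continuous)
  refine ⟨fun y => if hy : y ∈ U ∩ D then w ⟨y, hy⟩ else 1, fun a b β hβ => ?_⟩
  have ha : (a : X) ∈ U ∩ D := ⟨by simpa using hβ 0, a.2⟩
  have hb : (b : X) ∈ U ∩ D := ⟨by simpa using hβ 1, b.2⟩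
  simp only [dif_pos ha, dif_pos hb]
  let β' : Path (⟨a, ha⟩ : ↥(U ∩ D)) ⟨b, hb⟩ :=
    { toFun := fun t => ⟨β t, hβ t, (β t).2⟩
      continuous_toFun := by fun_prop
      source' := by simp
      target' := by simp }
  have h1 := T.map_homotopic ((SimplyConnectedSpace.paths_homotopic
    (PathConnectedSpace.somePath (⟨a, ha⟩ : ↥(U ∩ D)) b₀)
    (β'.trans (PathConnectedSpace.somePath (⟨b, hb⟩ : ↥(U ∩ D)) b₀))).map incl)
  rw [Path.map_trans, T.map_trans] at h1
  exact h1

/-- Transport multiplies both sections on the left by the same element, which cancels in the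
quotient. -/
lemma IsFlat.exists_inv_mul_eq (hu : T.IsFlat U u) (hv : T.IsFlat V v) (hW : W ⊆ U ∩ V)
    (hWD : IsPathConnected (W ∩ D)) : ∃ c, ∀ y ∈ W ∩ D, (u y)⁻¹ * v y = c := by
  obtain ⟨b, hb, hjoin⟩ := hWD
  refine ⟨(u b)⁻¹ * v b, fun y hy => ?_⟩
  obtain ⟨γ, hγ⟩ := hjoin hy
  let β : Path (⟨b, hb.2⟩ : D) ⟨y, hy.2⟩ :=
    { toFun := fun t => ⟨γ t, (hγ t).2⟩
      continuous_toFun := by fun_prop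
      source' := by simp
      target' := by simp }
  have h1 := hu β fun t => (hW (hγ t).1).1
  have h2 := hv β fun t => (hW (hγ t).1).2
  simp only at h1 h2
  rw [h1, h2]
  group

end PathRep

/-! ### Extending the local system across the frontier -/

/-- Every point of the closure of `D` has arbitrarily small open neighborhoods whose intersection
with `D` is simply connected. -/
def HasSimplyConnectedTraces {X : Type*} [TopologicalSpace X] (D : Set X) : Prop :=
  ∀ x ∈ closure D, ∀ O ∈ 𝓝 x, ∃ U ⊆ O, IsOpen U ∧ x ∈ U ∧ IsSimplyConnected (U ∩ D)

namespace HasSimplyConnectedTraces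

variable {X G : Type*} [TopologicalSpace X] [Group G] {D : Set X}

lemma exists_isOpen_inv_mul_eq (hD : HasSimplyConnectedTraces D) {T : PathRep D G}
    {U V : Set X} {u v : X → G} (hu : T.IsFlat U u) (hv : T.IsFlat V v)
    (hU : IsOpen U) (hV : IsOpen V) {x : X} (hx : x ∈ closure D) (hxU : x ∈ U) (hxV : x ∈ V) :
    ∃ (c : G) (W : Set X), IsOpen W ∧ x ∈ W ∧ ∀ y ∈ W ∩ D, (u y)⁻¹ * v y = c := by
  obtain ⟨W, hWO, hW, hxW, hsc⟩ := hD x hx (U ∩ V) ((hU.inter hV).mem_nhds ⟨hxU, hxV⟩)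
  obtain ⟨c, hc⟩ := hu.exists_inv_mul_eq hv hWO hsc.isPathConnected
  exact ⟨c, W, hW, hxW, hc⟩

/-- A local system on `D` can be trivialized along the frontier of `D` if the latter is simply
connected. -/
lemma exists_isFlat_frontier (hD : HasSimplyConnectedTraces D) (T : PathRep D G)
    [SimplyConnectedSpace (frontier D)] [LocallyPathConnectedSpace (frontier D)] :
    ∃ (W : frontier D → Set X) (u : frontier D → X → G),
      (∀ p, IsOpen (W p) ∧ (p : X) ∈ W p ∧ T.IsFlat (W p) (u p)) ∧
      ∀ p q, ∀ x ∈ frontier D, x ∈ W p → x ∈ W q → ∀ᶠ y in 𝓝[D] x, u p y = u q y := by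
  classical
  have h1 : ∀ p : frontier D, ∃ (U : Set X) (u : X → G), IsOpen U ∧ (p : X) ∈ U ∧ T.IsFlat U u := by
    intro p
    obtain ⟨U, -, hU, hpU, hsc⟩ := hD p (frontier_subset_closure p.2) univ univ_mem
    obtain ⟨u, hu⟩ := T.exists_isFlat hsc
    exact ⟨U, u, hU, hpU, hu⟩
  choose U u hU hpU hu using h1
  have h2 : ∀ p q x : frontier D, ∃ c : G, (x : X) ∈ U p → (x : X) ∈ U q →
      ∃ W : Set X, IsOpen W ∧ (x : X) ∈ W ∧ ∀ y ∈ W ∩ D, (u p y)⁻¹ * u q y = c := by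
    intro p q x
    by_cases h : (x : X) ∈ U p ∧ (x : X) ∈ U q
    · obtain ⟨c, hc⟩ := hD.exists_isOpen_inv_mul_eq (hu p) (hu q) (hU p) (hU q)
        (frontier_subset_closure x.2) h.1 h.2
      exact ⟨c, fun _ _ => hc⟩
    · exact ⟨1, fun hp hq => (h ⟨hp, hq⟩).elim⟩
  choose c hc using h2
  have hev : ∀ p q x : frontier D, (x : X) ∈ U p → (x : X) ∈ U q →
      ∀ᶠ y in 𝓝[D] (x : X), (u p y)⁻¹ * u q y = c p q x := by
    intro p q x hp hq
    obtain ⟨W, hW, hxW, h⟩ := hc p q x hp hq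
    filter_upwards [mem_nhdsWithin_of_mem_nhds (hW.mem_nhds hxW), self_mem_nhdsWithin]
      with y hy hyD using h y ⟨hy, hyD⟩
  -- Frontier points are limits of points of `D`, so the values `c` are determined by the sections
  -- on the side of `D`.
  have hne : ∀ x : frontier D, (𝓝[D] (x : X)).NeBot := fun x =>
    mem_closure_iff_nhdsWithin_neBot.1 (frontier_subset_closure x.2)
  let Z : CechCocycle (frontier D) (frontier D) G :=
    { baseSet := fun p => Subtype.val ⁻¹' U p
      isOpen_baseSet := fun p => (hU p).preimage continuous_subtype_val
      indexAt := id
      mem_baseSet_at := hpU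
      change := c
      change_mul := by
        rintro i j k x ⟨⟨hi, hj⟩, hk⟩
        have := hne x
        obtain ⟨y, hy1, hy2, hy3⟩ :=
          ((hev i j x hi hj).and ((hev j k x hj hk).and (hev i k x hi hk))).exists
        rw [← hy1, ← hy2, ← hy3]
        group
      eventually_change_eq := by
        rintro i j x ⟨hi, hj⟩
        obtain ⟨W, hW, hxW, h⟩ := hc i j x hi hj
        have hO : IsOpen (W ∩ (U i ∩ U j)) := hW.inter ((hU i).inter (hU j))
        filter_upwards [(hO.preimage continuous_subtype_val).mem_nhds ⟨hxW, hi, hj⟩]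
          with z hz
        have := hne z
        have h3 : ∀ᶠ y in 𝓝[D] (z : X), (u i y)⁻¹ * u j y = c i j x := by
          filter_upwards [mem_nhdsWithin_of_mem_nhds (hW.mem_nhds hz.1), self_mem_nhdsWithin]
            with y hy hyD using h y ⟨hy, hyD⟩
        obtain ⟨y, hy1, hy2⟩ := ((hev i j z hz.2.1 hz.2.2).and h3).exists
        rw [← hy1, ← hy2] }
  let _ : TopologicalSpace G := ⊥
  have : DiscreteTopology G := ⟨rfl⟩
  obtain ⟨s, hs, hsc⟩ := Z.exists_section
  have h3 : ∀ p : frontier D, ∃ O : Set X, IsOpen O ∧ (p : X) ∈ O ∧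
      ∀ y : frontier D, (y : X) ∈ O → s p y = s p p := by
    intro p
    have := hs p p (hpU p)
    rw [nhds_subtype_eq_comap, eventually_comap] at this
    obtain ⟨O, hO, hOo, hpO⟩ := eventually_nhds_iff.1 this
    exact ⟨O, hOo, hpO, fun y hy => hO y hy y rfl⟩
  choose O hO hpO hsO using h3
  -- As `s q = s p * c p q` and `u q = u p * c p q` near a common frontier point, the products `u p
  -- * (s p)⁻¹` agree there. On `O p` the factor `s p` is the constant `s p p`.
  refine ⟨fun p => U p ∩ O p, fun p y => u p y * (s p p)⁻¹, fun p =>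
    ⟨(hU p).inter (hO p), ⟨hpU p, hpO p⟩, ((hu p).mono inter_subset_left).mul_const _⟩, ?_⟩
  intro p q x hx hp hq
  filter_upwards [hev p q ⟨x, hx⟩ hp.1 hq.1] with y hy
  have h4 : s q ⟨x, hx⟩ = s p ⟨x, hx⟩ * c p q ⟨x, hx⟩ := hsc p q ⟨x, hx⟩ ⟨hp.1, hq.1⟩
  rw [hsO p ⟨x, hx⟩ hp.2, hsO q ⟨x, hx⟩ hq.2, ← hy] at h4
  rw [h4]
  group

/-- If the frontier of `D` is simply connected, a loop in `D` that is conjugate in the ambient space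
to a loop avoiding the closure of `D` is nullhomotopic in `D`. -/
theorem homotopic_refl (hD : HasSimplyConnectedTraces D) (hDo : IsOpen D)
    (hDc : IsPathConnected D)
    [SimplyConnectedSpace (frontier D)] [LocallyPathConnectedSpace (frontier D)]
    {x : D} (C : Path x x) {y : X} (γ : Path (x : X) y) (C' : Path y y)
    (hC' : range C' ⊆ (closure D)ᶜ)
    (hC : (C.map continuous_subtype_val).Homotopic ((γ.trans C').trans γ.symm)) :
    C.Homotopic (Path.refl x) := by
  classical
  have := isPathConnected_iff_pathConnectedSpace.1 hDc
  obtain ⟨T, hT⟩ := PathRep.exists_faithful x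
  refine hT C ?_
  obtain ⟨W, w, hW, hWw⟩ := hD.exists_isFlat_frontier T
  -- Sets attached to points off the frontier avoid the frontier, so near a frontier point only the
  -- compatible sections `w` overlap.
  have h1 : ∀ p : X, ∃ (U : Set X) (u : X → (FundamentalGroup D x)ᵐᵒᵖ),
      IsOpen U ∧ p ∈ U ∧ T.IsFlat U u ∧ (p ∉ frontier D → Disjoint U (frontier D)) ∧
      ∀ hp : p ∈ frontier D, U = W ⟨p, hp⟩ ∧ u = w ⟨p, hp⟩ := by
    intro p
    by_cases hpS : p ∈ frontier D
    · obtain ⟨ho, hm, hf⟩ := hW ⟨p, hpS⟩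
      exact ⟨_, _, ho, hm, hf, fun h => (h hpS).elim, fun _ => ⟨rfl, rfl⟩⟩
    by_cases hpD : p ∈ D
    · obtain ⟨U, hUD, hU, hpU, hsc⟩ := hD p (subset_closure hpD) D (hDo.mem_nhds hpD)
      obtain ⟨u, hu⟩ := T.exists_isFlat hsc
      refine ⟨U, u, hU, hpU, hu, fun _ => ?_, fun h => (hpS h).elim⟩
      exact (disjoint_iff_inter_eq_empty.2 hDo.inter_frontier_eq).mono_left hUD
    · have hpc : p ∉ closure D := fun h => hpS (by rw [hDo.frontier_eq]; exact ⟨h, hpD⟩)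
      refine ⟨(closure D)ᶜ, 1, isClosed_closure.isOpen_compl, hpc, fun a b β hβ => ?_,
        fun _ => ?_, fun h => (hpS h).elim⟩
      · exact (hβ 0 (subset_closure (β 0).2)).elim
      · exact disjoint_compl_left.mono_right frontier_subset_closure
  choose U u hU hpU hu hdisj hfr using h1
  -- Extension by 1 may jump at the frontier, but all `h p` defined there jump together, so their
  -- quotients are 1 nearby.
  let h : X → X → (FundamentalGroup D x)ᵐᵒᵖ := fun p z => if z ∈ D then u p z else 1
  have hflat : ∀ p, T.IsFlat (U p) (h p) := fun p a b β hβ => by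
    simp only [h, if_pos a.2, if_pos b.2]
    exact hu p β hβ
  have hfrontier : ∀ p q z, z ∈ frontier D → z ∈ U p → z ∈ U q →
      ∀ᶠ y in 𝓝[D] z, u p y = u q y := by
    intro p q z hz hp hq
    have hpS : p ∈ frontier D := by_contra fun h => (hdisj p h).ne_of_mem hp hz rfl
    have hqS : q ∈ frontier D := by_contra fun h => (hdisj q h).ne_of_mem hq hz rfl
    obtain ⟨e1, e2⟩ := hfr p hpS
    obtain ⟨e3, e4⟩ := hfr q hqS
    rw [e2, e4]
    exact hWw _ _ z hz (e1 ▸ hp) (e3 ▸ hq)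
  have hloc : ∀ p q, ∀ z ∈ U p ∩ U q,
      ∀ᶠ y in 𝓝 z, (h p y)⁻¹ * h q y = (h p z)⁻¹ * h q z := by
    rintro p q z ⟨hp, hq⟩
    by_cases hzD : z ∈ D
    · obtain ⟨c, W, hW, hzW, hc⟩ := hD.exists_isOpen_inv_mul_eq (hflat p) (hflat q) (hU p) (hU q)
        (subset_closure hzD) hp hq
      filter_upwards [(hW.inter hDo).mem_nhds ⟨hzW, hzD⟩] with y hy
      rw [hc y hy, hc z ⟨hzW, hzD⟩]
    · have hz1 : (h p z)⁻¹ * h q z = 1 := by simp [h, hzD]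
      rw [hz1]
      have hev : ∀ᶠ y in 𝓝[D] z, u p y = u q y := by
        by_cases hzc : z ∈ closure D
        · exact hfrontier p q z (by rw [hDo.frontier_eq]; exact ⟨hzc, hzD⟩) hp hq
        · rw [notMem_closure_iff_nhdsWithin_eq_bot.1 hzc]
          exact eventually_bot
      filter_upwards [eventually_nhdsWithin_iff.1 hev] with y hy
      by_cases hyD : y ∈ D
      · simp [h, hyD, hy hyD]
      · simp [h, hyD]
  have hcast : ∀ {a b a' b' : D} (p : Path a b) (ha : a' = a) (hb : b' = b),
      T.toFun (p.cast ha hb) = T.toFun p := by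
    rintro a b _ _ p rfl rfl
    rfl
  have hsub : ∀ t t' : unitInterval, T.toFun (C.subpath 0 t') =
      T.toFun (C.subpath 0 t) * T.toFun (C.subpath t t') := fun t t' => by
    rw [← T.map_trans]
    exact (T.map_homotopic ⟨Path.Homotopy.subpathTransSubpath C 0 t t'⟩).symm
  -- With `g t` the transport along `C` from time 0 to `t`, flatness makes `g t * h i (C t)` locally
  -- constant. The conclusion `g 0 = g 1` reads `1 = T.toFun C`.
  have key := eq_of_homotopic_conj U hU id hpU h hloc _ γ C' hC (fun t => ?_)
    (fun t => T.toFun (C.subpath 0 t)) (fun t => ?_)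
  · have h0 : T.toFun (C.subpath 0 0) = 1 := by
      have := hsub 0 0
      simpa using this
    rw [Path.subpath_zero_one, hcast, h0] at key
    exact key.symm
  · refine ⟨C' t, hpU _, Eventually.of_forall fun t' => ?_⟩
    have : ∀ s, C' s ∉ D := fun s hs => hC' (mem_range_self s) (subset_closure hs)
    simp [h, this]
  · refine ⟨C t, hpU _, ?_⟩
    have hcont : Continuous fun s => (C s : X) := by fun_prop
    have hopen : IsOpen ((fun s => (C s : X)) ⁻¹' U (C t)) := (hU _).preimage hcont
    obtain ⟨b, c, -, hJn, hJ⟩ := exists_Icc_mem_subset_of_mem_nhds (hopen.mem_nhds (hpU _))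
    filter_upwards [hJn] with t' ht'
    have h5 := hflat (C t) (C.subpath t t') (fun s => by
      have : C.subpath t t' s ∈ C '' uIcc t t' := by
        rw [← Path.range_subpath]
        exact mem_range_self s
      obtain ⟨r, hr, hr'⟩ := this
      rw [← hr']
      exact hJ (ordConnected_Icc.uIcc_subset (mem_of_mem_nhds hJn) ht' hr))
    change _ * h (C t) (C t') = _ * h (C t) (C t)
    rw [h5, hsub t t', mul_assoc]

end HasSimplyConnectedTraces

/-! ### Length spaces: Hopf–Rinow and existence of rays -/

/-- Approximate between points exist in `M`: this is a property of length spaces. -/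
def HasApproxBetween (M : Type*) [PseudoMetricSpace M] : Prop :=
  ∀ (x y : M) (a : ℝ), 0 ≤ a → a ≤ dist x y → ∀ ε > 0,
    ∃ z, dist x z = a ∧ dist z y < dist x y - a + ε

/-- A nearly shortest curve crosses the sphere of radius `a`, and the lengths of its two pieces
bound the two distances. -/
lemma IsRiemannianManifold.hasApproxBetween {E H M : Type*} [NormedAddCommGroup E]
    [NormedSpace ℝ E] [TopologicalSpace H] (J : ModelWithCorners ℝ E H) [MetricSpace M]
    [ChartedSpace H M] [RiemannianBundle (fun x : M => TangentSpace J x)]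
    [IsRiemannianManifold J M] : HasApproxBetween M := by
  intro x y a ha had ε hε
  have h1 : Manifold.riemannianEDist J x y < ENNReal.ofReal (dist x y + ε) := by
    rw [← IsRiemannianManifold.out (I := J) x y, edist_dist]
    exact (ENNReal.ofReal_lt_ofReal_iff (by positivity)).2 (by linarith)
  obtain ⟨γ, h0, h1, hγ, hlen⟩ := Manifold.exists_lt_of_riemannianEDist_lt h1
  have hc : ContinuousOn (fun t => dist x (γ t)) (Icc 0 1) :=
    (continuous_const.dist continuous_id).comp_continuousOn hγ.continuousOn
  obtain ⟨t, ht, hta⟩ := intermediate_value_Icc zero_le_one hc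
    (show a ∈ Icc (dist x (γ 0)) (dist x (γ 1)) by simp [h0, h1, ha, had])
  refine ⟨γ t, hta, ?_⟩
  have e1 : edist x (γ t) ≤ Manifold.pathELength J γ 0 t := by
    rw [IsRiemannianManifold.out (I := J)]
    exact Manifold.riemannianEDist_le_pathELength (hγ.mono (Icc_subset_Icc_right ht.2)) h0 rfl ht.1
  have e2 : edist (γ t) y ≤ Manifold.pathELength J γ t 1 := by
    rw [IsRiemannianManifold.out (I := J)]
    exact Manifold.riemannianEDist_le_pathELength (hγ.mono (Icc_subset_Icc_left ht.1)) rfl h1 ht.2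
  have e3 := (add_le_add e1 e2).trans_lt ((Manifold.pathELength_add ht.1 ht.2).trans_lt hlen)
  rw [edist_dist, edist_dist, ← ENNReal.ofReal_add dist_nonneg dist_nonneg,
    ENNReal.ofReal_lt_ofReal_iff (by positivity)] at e3
  have hta' : dist x (γ t) = a := hta
  linarith

namespace HasApproxBetween

variable {M : Type*} [MetricSpace M]

/-- The Hopf-Rinow theorem for length spaces. -/
theorem properSpace [CompleteSpace M] [LocallyCompactSpace M] (hM : HasApproxBetween M) :
    ProperSpace M := by
  refine ⟨fun x r₀ => ?_⟩
  by_contra hr₀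
  let N : Set ℝ := {r | ¬ IsCompact (Metric.closedBall x r)}
  have hN0 : ∀ r ∈ N, 0 ≤ r := fun r hr => by
    by_contra h
    exact hr (by rw [Metric.closedBall_eq_empty.2 (not_le.1 h)]; exact isCompact_empty)
  have hNne : N.Nonempty := ⟨r₀, hr₀⟩
  set R := sInf N
  have hR0 : 0 ≤ R := le_csInf hNne hN0
  have hlt : ∀ r < R, IsCompact (Metric.closedBall x r) := fun r hr => by
    by_contra h
    exact not_lt.2 (csInf_le ⟨0, hN0⟩ h) hr
  have hRc : IsCompact (Metric.closedBall x R) := by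
    refine TotallyBounded.isCompact_of_isClosed (Metric.totallyBounded_iff.2 fun ε hε => ?_)
      Metric.isClosed_closedBall
    obtain ⟨t, ht, htc⟩ := Metric.totallyBounded_iff.1
      (hlt (R - ε / 3) (by linarith)).totallyBounded (ε / 3) (by linarith)
    -- The extra center `x` covers the whole ball when `R < ε / 3`.
    refine ⟨insert x t, ht.insert x, fun z hz => ?_⟩
    rw [Metric.mem_closedBall'] at hz
    simp only [mem_iUnion, Metric.mem_ball, exists_prop, mem_insert_iff]
    by_cases hsmall : R - ε / 3 < 0
    · exact ⟨x, Or.inl rfl, by rw [dist_comm]; linarith⟩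
    obtain ⟨w, hw, hwz⟩ : ∃ w, dist x w ≤ R - ε / 3 ∧ dist w z < 2 * ε / 3 := by
      by_cases hzR : dist x z ≤ R - ε / 3
      · exact ⟨z, hzR, by simp; linarith⟩
      · obtain ⟨w, hw, hwz⟩ := hM x z (R - ε / 3) (not_lt.1 hsmall) (not_le.1 hzR).le (ε / 3)
          (by linarith)
        exact ⟨w, hw.le, by linarith⟩
    have hw' := htc (Metric.mem_closedBall'.2 hw)
    simp only [mem_iUnion, Metric.mem_ball, exists_prop] at hw'
    obtain ⟨y, hy, hyw⟩ := hw'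
    refine ⟨y, Or.inr hy, ?_⟩
    have := dist_triangle z w y
    rw [dist_comm z w] at this
    linarith
  obtain ⟨δ, hδ, hδc⟩ := hRc.exists_isCompact_cthickening
  have hbig : IsCompact (Metric.closedBall x (R + δ / 2)) := by
    refine hδc.of_isClosed_subset Metric.isClosed_closedBall fun z hz => ?_
    rw [Metric.mem_closedBall'] at hz
    by_cases hzR : dist x z ≤ R
    · exact Metric.self_subset_cthickening _ (Metric.mem_closedBall'.2 hzR)
    · obtain ⟨w, hw, hwz⟩ := hM x z R hR0 (not_le.1 hzR).le (δ / 2) (by linarith)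
      refine Metric.mem_cthickening_of_dist_le z w δ _ (Metric.mem_closedBall'.2 hw.le) ?_
      rw [dist_comm]
      linarith
  obtain ⟨r, hr, hrR⟩ := exists_lt_of_csInf_lt hNne (show R < R + δ / 2 by linarith)
  exact hr (hbig.of_isClosed_subset Metric.isClosed_closedBall
    (Metric.closedBall_subset_closedBall hrR.le))

variable [ProperSpace M]

lemma exists_between (hM : HasApproxBetween M) (x y : M) {a : ℝ} (ha : 0 ≤ a)
    (had : a ≤ dist x y) : ∃ z, dist x z = a ∧ dist z y = dist x y - a := by
  obtain ⟨z₀, hz₀, -⟩ := hM x y a ha had 1 one_pos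
  obtain ⟨z, hz, hmin⟩ := (isCompact_sphere x a).exists_isMinOn
    ⟨z₀, Metric.mem_sphere'.2 hz₀⟩
    (continuous_id.dist (continuous_const : Continuous fun _ => y)).continuousOn
  rw [Metric.mem_sphere'] at hz
  refine ⟨z, hz, le_antisymm (le_of_forall_pos_le_add fun ε hε => ?_) ?_⟩
  · obtain ⟨w, hw, hwy⟩ := hM x y a ha had ε hε
    exact (hmin (Metric.mem_sphere'.2 hw)).trans hwy.le
  · have := dist_triangle x z y
    linarith

/-- Times are added in increasing order: the new point is taken between the last one and `y`.
Keeping the exact distance to `y` forces equality in all the triangle inequalities. -/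
lemma exists_chain (hM : HasApproxBetween M) (x y : M) (F : Finset ℝ≥0)
    (hF : ∀ t ∈ F, (t : ℝ) ≤ dist x y) :
    ∃ γ : ℝ≥0 → M, (∀ t ∈ F, dist x (γ t) = t ∧ dist (γ t) y = dist x y - t) ∧
      ∀ s ∈ F, ∀ t ∈ F, dist (γ s) (γ t) = dist s t := by
  induction F using Finset.induction_on_max with
  | empty => exact ⟨fun _ => x, by simp, by simp⟩
  | insert a F hlt ih =>
    obtain ⟨γ, hγ, hγd⟩ := ih fun t ht => hF t (Finset.mem_insert_of_mem ht)
    have had : (a : ℝ) ≤ dist x y := hF a (Finset.mem_insert_self _ _)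
    obtain ⟨m, z, hma, hz, hzy, hFz⟩ : ∃ (m : ℝ≥0) (z : M), m ≤ a ∧ dist x z = m ∧
        dist z y = dist x y - m ∧ ∀ s ∈ F, dist (γ s) z = m - s := by
      rcases F.eq_empty_or_nonempty with rfl | hne
      · exact ⟨0, x, zero_le, by simp, by simp, by simp⟩
      · have hm := F.max'_mem hne
        refine ⟨F.max' hne, γ (F.max' hne), (hlt _ hm).le, (hγ _ hm).1, (hγ _ hm).2,
          fun s hs => ?_⟩
        have hsm : (s : ℝ) ≤ F.max' hne := F.le_max' s hs
        rw [hγd s hs _ hm, NNReal.dist_eq, abs_sub_comm, abs_of_nonneg (by linarith)]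
    have hma' : (m : ℝ) ≤ a := hma
    obtain ⟨w, hw, hwy⟩ := hM.exists_between z y (a := a - m) (by linarith) (by linarith)
    have hFa : ∀ s ∈ F, dist (γ s) w = a - s := fun s hs => by
      have h1 := dist_triangle (γ s) z w
      have h2 := dist_triangle (γ s) w y
      have h3 := hFz s hs
      have h4 := (hγ s hs).2
      linarith
    have hxw : dist x w = a := by
      have h1 := dist_triangle x z w
      have h2 := dist_triangle x w y
      linarith
    have hup : ∀ s ∈ F, Function.update γ a w s = γ s := fun s hs =>
      Function.update_of_ne (hlt s hs).ne _ _
    refine ⟨Function.update γ a w, fun t ht => ?_, fun s hs t ht => ?_⟩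
    · rcases Finset.mem_insert.1 ht with rfl | ht
      · simp only [Function.update_self]
        exact ⟨hxw, by linarith⟩
      · rw [hup t ht]
        exact hγ t ht
    · have hdist : ∀ s ∈ F, dist (γ s) w = dist s a := fun s hs => by
        have : (s : ℝ) < a := hlt s hs
        rw [hFa s hs, NNReal.dist_eq, abs_sub_comm, abs_of_pos (by linarith)]
      rcases Finset.mem_insert.1 hs with rfl | hsF <;>
        rcases Finset.mem_insert.1 ht with rfl | htF
      · simp
      · rw [hup t htF, Function.update_self, dist_comm, hdist t htF, dist_comm]
      · rw [hup s hsF, Function.update_self, hdist s hsF]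
      · rw [hup s hsF, hup t htF, hγd s hsF t htF]

/-- In a proper noncompact length space, there is a ray starting at every point. -/
theorem exists_ray [NoncompactSpace M] (hM : HasApproxBetween M) (x : M) :
    ∃ γ : Ray M, γ 0 = x := by
  classical
  have hfar : ∀ r : ℝ, ∃ y, r ≤ dist x y := fun r => by
    by_contra! h
    refine noncompact_univ M ((isCompact_closedBall x r).of_isClosed_subset isClosed_univ
      fun y _ => Metric.mem_closedBall'.2 (h y).le)
  have hsph : ∀ t : ℝ≥0, ∃ z, dist x z = t := fun t => by
    obtain ⟨y, hy⟩ := hfar t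
    obtain ⟨z, hz, -⟩ := hM.exists_between x y t.2 hy
    exact ⟨z, hz⟩
  choose z hz using hsph
  let P : Set (ℝ≥0 → M) := univ.pi fun t => Metric.sphere x t
  have hP : IsCompact P := isCompact_univ_pi fun t => isCompact_sphere x t
  -- Tychonoff compactness replaces a limit of minimal segments: each finite set of isometry
  -- conditions is met by a chain towards a far point, so all of them can be met at once.
  let A : Finset ℝ≥0 → Set (ℝ≥0 → M) := fun F =>
    P ∩ {γ | ∀ s ∈ F, ∀ t ∈ F, dist (γ s) (γ t) = dist s t}
  have hAc : ∀ F, IsClosed (A F) := fun F => by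
    refine hP.isClosed.inter ?_
    simp only [Set.ofPred_forall]
    refine isClosed_iInter fun s => isClosed_iInter fun _ => isClosed_iInter fun t =>
      isClosed_iInter fun _ => isClosed_eq (by fun_prop) continuous_const
  obtain ⟨γ, hγ⟩ := IsCompact.nonempty_iInter_of_directed_nonempty_isCompact_isClosed A
    (fun F F' => ⟨F ∪ F', fun γ h => ⟨h.1, fun s hs t ht => h.2 s (Finset.mem_union_left _ hs) t
      (Finset.mem_union_left _ ht)⟩, fun γ h => ⟨h.1, fun s hs t ht =>
      h.2 s (Finset.mem_union_right _ hs) t (Finset.mem_union_right _ ht)⟩⟩)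
    (fun F => by
      obtain ⟨y, hy⟩ := hfar (F.sup id : ℝ≥0)
      obtain ⟨γ, h1, h2⟩ := hM.exists_chain x y F fun t ht => by
        refine le_trans ?_ hy
        exact_mod_cast F.le_sup (f := id) ht
      refine ⟨fun t => if t ∈ F then γ t else z t, fun t _ => ?_, fun s hs t ht => ?_⟩
      · rw [Metric.mem_sphere']
        dsimp only
        split_ifs with ht
        · exact (h1 t ht).1
        · exact hz t
      · simp only [if_pos hs, if_pos ht]
        exact h2 s hs t ht)
    (fun F => hP.of_isClosed_subset (hAc F) inter_subset_left) hAc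
  rw [mem_iInter] at hγ
  refine ⟨⟨γ, Isometry.of_dist_eq fun s t =>
    (hγ {s, t}).2 s (by simp) t (by simp)⟩, ?_⟩
  have h0 := (hγ ∅).1 0 (mem_univ _)
  rw [Metric.mem_sphere] at h0
  exact dist_eq_zero.1 (by simpa using h0)

end HasApproxBetween

/-! ### Local topology of `D` and of its frontier in charts -/

namespace OpenPartialHomeomorph

variable {M E : Type*} [TopologicalSpace M] [NormedAddCommGroup E] [NormedSpace ℝ E]

/-- The pullback of a convex set in the target of a chart is simply connected. -/
lemma isSimplyConnected_preimage_of_convex (φ : OpenPartialHomeomorph M E) {s : Set E}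
    (hs : Convex ℝ s) (hne : s.Nonempty) (hst : s ⊆ φ.target) :
    IsSimplyConnected (φ.source ∩ φ ⁻¹' s) := by
  let f : φ.target → M := fun y => φ.toHomeomorphSourceTarget.symm y
  have hf : IsEmbedding f :=
    IsEmbedding.subtypeVal.comp φ.toHomeomorphSourceTarget.symm.isEmbedding
  have h1 : IsSimplyConnected s := by
    have := hs.contractibleSpace hne
    exact SimplyConnectedSpace.ofContractible s
  have h2 : IsSimplyConnected (Subtype.val ⁻¹' s : Set φ.target) := by
    rwa [← IsEmbedding.subtypeVal.isSimplyConnected_image, Subtype.image_preimage_coe,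
      inter_eq_right.2 hst]
  have h3 : φ.source ∩ φ ⁻¹' s = f '' (Subtype.val ⁻¹' s) := by
    ext z
    constructor
    · rintro ⟨hz, hzs⟩
      exact ⟨⟨φ z, φ.map_source hz⟩, hzs, φ.left_inv hz⟩
    · rintro ⟨y, hy, rfl⟩
      refine ⟨φ.map_target y.2, ?_⟩
      change φ (φ.symm y) ∈ s
      rw [φ.right_inv y.2]
      exact hy
  rw [h3, hf.isSimplyConnected_image]
  exact h2

/-- Small chart balls have simply connected intersections with the pullbacks of a convex set. -/
lemma exists_isSimplyConnected_inter_preimage (φ : OpenPartialHomeomorph M E) {x : M}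
    (hx : x ∈ φ.source) {O : Set M} (hO : O ∈ 𝓝 x) {s : Set E} (hs : Convex ℝ s)
    (hxs : x ∈ closure (φ.source ∩ φ ⁻¹' s)) :
    ∃ U ⊆ O, IsOpen U ∧ x ∈ U ∧ U ⊆ φ.source ∧ IsSimplyConnected (U ∩ φ ⁻¹' s) := by
  have h1 : φ.target ∩ φ.symm ⁻¹' O ∈ 𝓝 (φ x) := by
    refine inter_mem (φ.open_target.mem_nhds (φ.map_source hx)) ?_
    exact (φ.continuousAt_symm (φ.map_source hx)).preimage_mem_nhds (by rwa [φ.left_inv hx])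
  obtain ⟨ε, hε, hball⟩ := Metric.mem_nhds_iff.1 h1
  have hU : IsOpen (φ.source ∩ φ ⁻¹' Metric.ball (φ x) ε) :=
    φ.isOpen_inter_preimage Metric.isOpen_ball
  have hxU : x ∈ φ.source ∩ φ ⁻¹' Metric.ball (φ x) ε := ⟨hx, Metric.mem_ball_self hε⟩
  refine ⟨_, fun z hz => ?_, hU, hxU, inter_subset_left, ?_⟩
  · have := (hball hz.2).2
    rwa [mem_preimage, φ.left_inv hz.1] at this
  · rw [inter_assoc, ← preimage_inter]
    refine φ.isSimplyConnected_preimage_of_convex ((convex_ball _ _).inter hs) ?_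
      fun y hy => (hball hy.1).1
    obtain ⟨z, hz, hz'⟩ := mem_closure_iff.1 hxs _ hU hxU
    exact ⟨φ z, hz.2, hz'.2⟩

end OpenPartialHomeomorph

section Charts

variable {n : ℕ} {M : Type*} [TopologicalSpace M] {D : Set M}

lemma mem_frontier_iff_of_chart (hD : IsOpen D)
    (φ : OpenPartialHomeomorph M (EuclideanSpace ℝ (Fin n))) (i : Fin n)
    (hφ : ∀ x ∈ φ.source, x ∈ D ↔ φ x i < 0) {x : M} (hx : x ∈ φ.source) :
    x ∈ frontier D ↔ φ x i = 0 := by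
  have hcoord : Continuous fun y : EuclideanSpace ℝ (Fin n) => y i := by fun_prop
  rw [hD.frontier_eq]
  constructor
  · rintro ⟨hxc, hxD⟩
    rw [hφ x hx, not_lt] at hxD
    refine le_antisymm (not_lt.1 fun hpos => ?_) hxD
    have hO : IsOpen (φ.source ∩ φ ⁻¹' {y | 0 < y i}) :=
      φ.isOpen_inter_preimage (isOpen_lt continuous_const hcoord)
    obtain ⟨z, ⟨hz, hz'⟩, hzD⟩ := mem_closure_iff.1 hxc _ hO ⟨hx, hpos⟩
    exact lt_asymm ((hφ z hz).1 hzD) hz'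
  · intro h0
    refine ⟨?_, by rw [hφ x hx, h0]; exact lt_irrefl 0⟩
    -- Moving against the `i`-th coordinate direction enters `D`.
    let c : ℝ → EuclideanSpace ℝ (Fin n) := fun t => φ x - t • EuclideanSpace.single i 1
    have hc : ContinuousAt c 0 := by fun_prop
    have hc0 : c 0 = φ x := by simp [c]
    have hct : ∀ᶠ t in 𝓝[>] (0 : ℝ), c t ∈ φ.target :=
      (hc.eventually (by rw [hc0]; exact φ.open_target.mem_nhds (φ.map_source hx))).filter_mono
        nhdsWithin_le_nhds
    have hlim : Tendsto (fun t => φ.symm (c t)) (𝓝[>] (0 : ℝ)) (𝓝 x) := by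
      have h1 := (φ.continuousAt_symm (φ.map_source hx)).tendsto
      rw [φ.left_inv hx, ← hc0] at h1
      exact (h1.comp hc.tendsto).mono_left nhdsWithin_le_nhds
    refine mem_closure_of_tendsto hlim ?_
    filter_upwards [hct, self_mem_nhdsWithin] with t ht ht0
    rw [hφ _ (φ.map_target ht), φ.right_inv ht]
    simpa [c, h0] using ht0

lemma convex_coord (i : Fin n) {s : Set ℝ} (hs : Convex ℝ s) :
    Convex ℝ {y : EuclideanSpace ℝ (Fin n) | y i ∈ s} := by
  intro y hy z hz a b ha hb hab
  simpa using hs hy hz ha hb hab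

variable [ChartedSpace (EuclideanSpace ℝ (Fin n)) M]

/-- In a chart the trace is a ball, or at the boundary a ball cut by an open half-space; both are
convex. -/
lemma HasSmoothBoundary.hasSimplyConnectedTraces (hDo : IsOpen D) (hD : HasSmoothBoundary n D) :
    HasSimplyConnectedTraces D := by
  intro x hx O hO
  by_cases hxD : x ∈ D
  · let φ := chartAt (EuclideanSpace ℝ (Fin n)) x
    have hxs : x ∈ φ.source := mem_chart_source _ x
    obtain ⟨U, hUO, hU, hxU, -, hsc⟩ := φ.exists_isSimplyConnected_inter_preimage hxs
      (inter_mem hO (hDo.mem_nhds hxD)) convex_univ (subset_closure ⟨hxs, mem_univ _⟩)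
    refine ⟨U, hUO.trans inter_subset_left, hU, hxU, ?_⟩
    rw [inter_eq_left.2 (hUO.trans inter_subset_right)]
    rwa [preimage_univ, inter_univ] at hsc
  · obtain ⟨φ, -, hxs, i, hφ⟩ := hD x (by rw [hDo.frontier_eq]; exact ⟨hx, hxD⟩)
    have heq : ∀ V ⊆ φ.source, V ∩ D = V ∩ φ ⁻¹' {y | y i ∈ Iio 0} := fun V hV => by
      ext z
      exact and_congr_right fun hz => hφ z (hV hz)
    have hxc : x ∈ closure (φ.source ∩ φ ⁻¹' {y | y i ∈ Iio 0}) := by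
      rw [← heq _ subset_rfl]
      refine mem_closure_iff.2 fun W hW hxW => ?_
      obtain ⟨z, hz, hzD⟩ := mem_closure_iff.1 hx _ (hW.inter φ.open_source) ⟨hxW, hxs⟩
      exact ⟨z, hz.1, hz.2, hzD⟩
    obtain ⟨U, hUO, hU, hxU, hUs, hsc⟩ := φ.exists_isSimplyConnected_inter_preimage hxs hO
      (convex_coord i (convex_Iio 0)) hxc
    exact ⟨U, hUO, hU, hxU, by rwa [heq U hUs]⟩

/-- In a boundary chart the frontier is a coordinate hyperplane, whose intersection with a ball is
convex. -/
lemma HasSmoothBoundary.locallyPathConnectedSpace_frontier (hDo : IsOpen D)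
    (hD : HasSmoothBoundary n D) : LocallyPathConnectedSpace (frontier D) := by
  refine ⟨fun x => hasBasis_self.2 fun t ht => ?_⟩
  obtain ⟨O, hO, hOt⟩ := mem_nhds_subtype _ _ _ |>.1 ht
  obtain ⟨φ, -, hxs, i, hφ⟩ := hD x x.2
  have heq : ∀ V ⊆ φ.source, frontier D ∩ V = V ∩ φ ⁻¹' {y | y i ∈ ({0} : Set ℝ)} :=
    fun V hV => by
      rw [inter_comm]
      ext z
      exact and_congr_right fun hz => mem_frontier_iff_of_chart hDo φ i hφ (hV hz)
  obtain ⟨U, hUO, hU, hxU, hUs, hsc⟩ := φ.exists_isSimplyConnected_inter_preimage hxs hO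
    (convex_coord i (convex_singleton (0 : ℝ)))
    (subset_closure (by rw [← heq _ subset_rfl]; exact ⟨x.2, hxs⟩))
  refine ⟨Subtype.val ⁻¹' U, (hU.preimage continuous_subtype_val).mem_nhds hxU, ?_,
    (preimage_mono hUO).trans hOt⟩
  rw [IsInducing.subtypeVal.isPathConnected_iff, Subtype.image_preimage_coe, heq U hUs]
  exact hsc.isPathConnected

end Charts

/-! ### The main theorem -/

theorem corollary18 (n : ℕ) {M : Type*} [MetricSpace M]
    [ChartedSpace (EuclideanSpace ℝ (Fin n)) M] [IsManifold (𝓡 n) ∞ M]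
    [RiemannianBundle (fun x : M => TangentSpace (𝓡 n) x)]
    [IsContMDiffRiemannianBundle (𝓡 n) ∞ (EuclideanSpace ℝ (Fin n))
      (fun x : M => TangentSpace (𝓡 n) x)]
    [IsRiemannianManifold (𝓡 n) M]
    [ConnectedSpace M] [CompleteSpace M] [NoncompactSpace M]
    (hM : LoopsToInfinity M)
    (D : Set M) (hD : IsPrecompactSmoothRegion n D)
    (hbd : SimplyConnectedSpace (frontier D)) :
    ∀ x : D, Subsingleton (FundamentalGroup D x) := by
  have : LocallyCompactSpace M := ChartedSpace.locallyCompactSpace (EuclideanSpace ℝ (Fin n)) M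
  have : LocallyPathConnectedSpace M :=
    ChartedSpace.locallyPathConnectedSpace (EuclideanSpace ℝ (Fin n)) M
  have hlen : HasApproxBetween M := IsRiemannianManifold.hasApproxBetween (𝓡 n)
  have : ProperSpace M := hlen.properSpace
  have hDo := hD.isOpen
  have htr := hD.hasSmoothBoundary.hasSimplyConnectedTraces hDo
  have : LocallyPathConnectedSpace (frontier D) :=
    hD.hasSmoothBoundary.locallyPathConnectedSpace_frontier hDo
  have hDc : IsPathConnected D := hDo.isConnected_iff_isPathConnected.1 hD.isConnected
  rintro ⟨x, hx⟩
  obtain ⟨γ, rfl⟩ := hlen.exists_ray x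
  refine subsingleton_of_forall_eq 1 fun g => ?_
  obtain ⟨C, rfl⟩ := Path.Homotopic.Quotient.mk_surjective g
  -- The compact set to be avoided is `closure D`, and the loop is `C` viewed in `M`.
  obtain ⟨C₁, hC₁, y, C', hC', r, -, rfl, hr⟩ := hM γ
    (FundamentalGroup.fromPath (.mk (C.map continuous_subtype_val))) (closure D)
    hD.isCompact_closure
  have h1 : C₁.Homotopic (C.map continuous_subtype_val) := Path.Homotopic.Quotient.exact hC₁
  exact Path.Homotopic.Quotient.eq.2
    (htr.homotopic_refl hDo hDc C (γ.segment r) C' hC' (hr.trans h1).symm)
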